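/- For an integer $k\ge 2$ and a real $F\ge 0$ let \[ \mathcal F_{k,F}=\Big\{ f(x)=\sum_{j=1}^k v_j e^{2\pi \mathbf i f_j x} \;\Big|\; v_j\in\mathbb C,\ f_j\in\mathbb R,\ |f_j|\le F\Big\}. \] Let $D$ be the uniform distribution on $[-1,1]$, with density $D(x)=\tfrac12$, and let $\|f\|_D^2=\mathbb E_{x\sim D}[|f(x)|^2]$. There are absolute constants $C>0$ and $0<c_1\le c_2$ such that the following holds for every integer $k\ge 2$. (1) For every $F\ge 0$, \[ \kappa=\mathbb E_{x\sim D}\Big[\sup_{f\in\mathcal F_{k,F},\,f\ne 0}\frac{|f(x)|^2}{\|f\|_D^2}\Big]\le C\,k\log^2 k . \] (2) There is a number $c=c(k)\in[c_1,c_2]$, not depending on $F$, such that \[ D_{\mathcal F}(x)=\begin{cases}\dfrac{c}{(1-|x|)\log k}, & |x|\le 1-\dfrac1{k^3\log^2 k},\\[2mm] c\,k^3\log k, & 1-\dfrac1{k^3\log^2 k}<|x|\le 1,\end{cases} \] is a probability density on $[-1,1]$ and, for every $F\ge 0$, every $f\in\mathcal F_{k,F}$ and every $x\in[-1,1]$,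 \[ |f(x)|^2\cdot\frac{D(x)}{D_{\mathcal F}(x)}\le C\,k\log^2 k\cdot\|f\|_D^2 . \] Equivalently, the reweighted condition number satisfies \[ \sup_{x\in[-1,1]}\Big\{\frac{D(x)}{D_{\mathcal F}(x)}\cdot\sup_{f\in\mathcal F_{k,F},\,f\ne0}\frac{|f(x)|^2}{\|f\|_D^2}\Big\}\le C\,k\log^2 k . \] -/

import Mathlib

open Real Set MeasureTheory

/-- Signals `f(x) = ∑_{j=1}^k v_j e^{2πi ξ_j x}` with complex coefficients `v_j` and real
frequencies `|ξ_j| ≤ F`. Repeated frequencies and zero coefficients are allowed. -/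
def fourierSparse (k : ℕ) (F : ℝ) : Set (ℝ → ℂ) :=
  {f | ∃ (v : Fin k → ℂ) (ξ : Fin k → ℝ), (∀ j, |ξ j| ≤ F) ∧
    ∀ x : ℝ, f x = ∑ j, v j * Complex.exp (2 * (π : ℂ) * Complex.I * (ξ j : ℂ) * (x : ℂ))}

/-- The measure on `[-1, 1]` with density `p` with respect to Lebesgue measure. -/
noncomputable def densityMeasure (p : ℝ → ℝ) : Measure ℝ :=
  (volume.restrict (Icc (-1 : ℝ) 1)).withDensity (fun x => ENNReal.ofReal (p x))

/-- The density of the uniform distribution `D` on `[-1, 1]`. -/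
noncomputable def uniformDensity : ℝ → ℝ := fun _ => 1 / 2

/-- The uniform distribution `D` on `[-1, 1]`. -/
noncomputable def uniformMeasure : Measure ℝ := densityMeasure uniformDensity

/-- `‖f‖_D² = E_{x ∼ D} |f(x)|²`. -/
noncomputable def normSqD (f : ℝ → ℂ) : ℝ := ∫ x, ‖f x‖ ^ 2 ∂uniformMeasure

/-- `sup_{f ∈ 𝓕, f ≠ 0} |f(x)|² / ‖f‖_D²`, a value in `[0, ∞]`. -/
noncomputable def supRatio (𝓕 : Set (ℝ → ℂ)) (x : ℝ) : ENNReal :=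
  ⨆ f ∈ {f ∈ 𝓕 | f ≠ 0}, ENNReal.ofReal (‖f x‖ ^ 2 / normSqD f)

/-- `κ = E_{x ∼ D} [ sup_{f ∈ 𝓕, f ≠ 0} |f(x)|² / ‖f‖_D² ]`. -/
noncomputable def kappa (𝓕 : Set (ℝ → ℂ)) : ENNReal :=
  ∫⁻ x, supRatio 𝓕 x ∂uniformMeasure

/-- The reweighted condition number of sampling from the density `p` on `[-1, 1]`:
`K_p = sup_{x ∈ [-1, 1]} (D(x) / p(x)) · sup_{f ∈ 𝓕, f ≠ 0} |f(x)|² / ‖f‖_D²`. -/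
noncomputable def reweightedConditionNumber (𝓕 : Set (ℝ → ℂ)) (p : ℝ → ℝ) : ENNReal :=
  ⨆ x ∈ Icc (-1 : ℝ) 1, ENNReal.ofReal (uniformDensity x / p x) * supRatio 𝓕 x

/-- The explicit sampling density `D_𝓕` with normalizing factor `c`. -/
noncomputable def sparseDensity (k : ℕ) (c : ℝ) (x : ℝ) : ℝ :=
  if |x| ≤ 1 - 1 / ((k : ℝ) ^ 3 * Real.log k ^ 2) then
    c / ((1 - |x|) * Real.log k)
  else
    c * (k : ℝ) ^ 3 * Real.log k

/-! The theorem reduces to two pointwise bounds for sums of `k` exponentials with purely imaginary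
exponents. Their constants depend only on `k`, so they are uniform in `F`.

Interior (`mul_norm_expSum_sq_le`): on a window of length `r`, the diagonal of the reproducing
kernel of the span of the exponentials has integral at most its dimension `k`. The span is
translation invariant, so `f x` may be read off at any position `s` of the window; averaging over
`s` gives `|f x|² ≲ k ‖f‖² / (1 - |x|)`.

Endpoint (`norm_expSum_left_endpoint_sq_le`): multiplying by `exp (-ε t)` shifts every exponent by
`-ε`. A Lyapunov identity for the Gram matrix on `[0, 1]` then bounds the kernel diagonal at `0` by
its value at `1` plus `2 ε k`. With `ε` of order `k²` the weight at `1` beats the growth factor `2 ^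
O(k²)` of the sums, so the value at `1` is `O(k)` and that at `0` is `O(k³)`.

The sampling density is the smaller of these two envelopes up to logarithms, and its mass before
normalization by `c` lies in `[2, 14]`. This yields the reweighted bound, and integrating that bound
against the density yields the bound on `κ`. -/

/-! ### Reproducing kernels of regularized Gram matrices. -/

section Matrices

open Matrix
open scoped ComplexOrder

variable {ι : Type*} [Fintype ι] [DecidableEq ι]

/-- The diagonal value at the evaluation functional `φ` of the reproducing kernel of the inner
product with Gram matrix `H`. -/
noncomputable def kernelDiag (H : Matrix ι ι ℂ) (φ : ι → ℂ) : ℝ :=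
  (H⁻¹ * vecMulVec (star φ) φ).trace.re

omit [DecidableEq ι] in
lemma trace_mul_vecMulVec_star (A : Matrix ι ι ℂ) (φ : ι → ℂ) :
    (A * vecMulVec (star φ) φ).trace = φ ⬝ᵥ (A *ᵥ star φ) := by
  rw [mul_vecMulVec, trace_vecMulVec, dotProduct_comm]

lemma Matrix.PosDef.mulVec_inv_mulVec {H : Matrix ι ι ℂ} (hH : H.PosDef) (φ : ι → ℂ) :
    H *ᵥ (H⁻¹ *ᵥ φ) = φ := by
  rw [mulVec_mulVec, Matrix.mul_nonsing_inv _ ((isUnit_iff_isUnit_det _).1 hH.isUnit), one_mulVec]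

lemma kernelDiag_nonneg {H : Matrix ι ι ℂ} (hH : H.PosDef) (φ : ι → ℂ) : 0 ≤ kernelDiag H φ := by
  have h := hH.inv.posSemidef.dotProduct_mulVec_nonneg (star φ)
  rw [star_star, ← trace_mul_vecMulVec_star] at h
  exact (Complex.le_def.1 h).1

lemma ofReal_kernelDiag {H : Matrix ι ι ℂ} (hH : H.PosDef) (φ : ι → ℂ) :
    (kernelDiag H φ : ℂ) = φ ⬝ᵥ (H⁻¹ *ᵥ star φ) := by
  have h := hH.inv.posSemidef.dotProduct_mulVec_nonneg (star φ)
  rw [star_star, ← trace_mul_vecMulVec_star] at h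
  rw [← trace_mul_vecMulVec_star]
  exact Complex.ext rfl (Complex.le_def.1 h).2

lemma star_inv_mulVec_dotProduct {H : Matrix ι ι ℂ} (hH : H.PosDef) (φ v : ι → ℂ) :
    star (H⁻¹ *ᵥ star φ) ⬝ᵥ (H *ᵥ v) = φ ⬝ᵥ v := by
  rw [dotProduct_mulVec, ← hH.isHermitian.eq, ← star_mulVec, hH.isHermitian.eq,
    hH.mulVec_inv_mulVec, star_star]

/-- Cauchy–Schwarz for the form `H`: `w = H⁻¹ φ*` represents the functional `φ`, and its squared
`H`-norm is the kernel diagonal. -/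
lemma norm_dotProduct_sq_le_kernelDiag {H : Matrix ι ι ℂ} (hH : H.PosDef) (φ v : ι → ℂ) :
    ‖φ ⬝ᵥ v‖ ^ 2 ≤ kernelDiag H φ * (star v ⬝ᵥ (H *ᵥ v)).re := by
  set w := H⁻¹ *ᵥ star φ with hw
  set c := φ ⬝ᵥ v with hc
  have hK := ofReal_kernelDiag hH φ
  have hK0 := kernelDiag_nonneg hH φ
  set K := kernelDiag H φ with hKdef
  have hww : star w ⬝ᵥ (H *ᵥ w) = K := by rw [hw, star_inv_mulVec_dotProduct hH, hK]
  have hwv : star w ⬝ᵥ (H *ᵥ v) = c := star_inv_mulVec_dotProduct hH φ v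
  have hvw : star v ⬝ᵥ (H *ᵥ w) = star c := by
    rw [hw, hH.mulVec_inv_mulVec, hc, star_dotProduct_star, dotProduct_comm]
  rcases hK0.eq_or_lt with h0 | hpos
  · have hw0 : w = 0 := by
      by_contra hne
      have := hH.dotProduct_mulVec_pos hne
      rw [hww, ← h0] at this
      simp at this
    have : c = 0 := by rw [← hwv, hw0]; simp
    simp [this, ← h0]
  -- Positivity of the form at `K v - c w`, the component of `v` orthogonal to `w` scaled by `K` to
  -- avoid division.
  · have h := hH.posSemidef.dotProduct_mulVec_nonneg ((K : ℂ) • v - c • w)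
    have h2 : star ((K : ℂ) • v - c • w) ⬝ᵥ (H *ᵥ ((K : ℂ) • v - c • w))
        = K * (K * (star v ⬝ᵥ (H *ᵥ v)) - star c * c) := by
      simp only [star_sub, star_smul, mulVec_sub, mulVec_smul, sub_dotProduct, dotProduct_sub,
        smul_dotProduct, dotProduct_smul, smul_eq_mul, hww, hwv, hvw, Complex.star_def,
        Complex.conj_ofReal]
      ring
    rw [h2] at h
    have h3 := (Complex.le_def.1 h).1
    have h4 : star c * c = ((‖c‖ ^ 2 : ℝ) : ℂ) := by
      rw [Complex.star_def, Complex.conj_mul']; norm_cast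
    rw [h4, Complex.re_ofReal_mul, Complex.sub_re, Complex.re_ofReal_mul, Complex.ofReal_re,
      Complex.zero_re] at h3
    linarith [nonneg_of_mul_nonneg_right h3 hpos]

/-- The kernel diagonal is the best constant: testing on the representer gives `K² ≤ B K`. -/
lemma kernelDiag_le {H : Matrix ι ι ℂ} (hH : H.PosDef) (φ : ι → ℂ) {B : ℝ} (hB : 0 ≤ B)
    (h : ∀ v : ι → ℂ, ‖φ ⬝ᵥ v‖ ^ 2 ≤ B * (star v ⬝ᵥ (H *ᵥ v)).re) : kernelDiag H φ ≤ B := by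
  have h1 := h (H⁻¹ *ᵥ star φ)
  rw [star_inv_mulVec_dotProduct hH, ← ofReal_kernelDiag hH, Complex.norm_real, Complex.ofReal_re,
    Real.norm_eq_abs, sq_abs] at h1
  by_contra! hlt
  nlinarith

variable (φ : ι → ℝ → ℂ) (a b : ℝ)

/-- The Gram matrix of the functions `φ i` in `L²(a, b)`. -/
noncomputable def gramMatrix : Matrix ι ι ℂ :=
  of fun i j => ∫ t in a..b, star (φ i t) * φ j t

variable {φ a b}

omit [Fintype ι] [DecidableEq ι] in
lemma gramMatrix_isHermitian : (gramMatrix φ a b).IsHermitian := by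
  ext i j
  simp only [gramMatrix, conjTranspose_apply, of_apply, Complex.star_def]
  simp only [intervalIntegral.intervalIntegral_eq_integral_uIoc, Complex.real_smul, map_mul,
    Complex.conj_ofReal, ← integral_conj, Complex.conj_conj]
  simp_rw [mul_comm]

omit [DecidableEq ι] in
lemma dotProduct_gramMatrix (hφ : ∀ i, Continuous (φ i)) (v : ι → ℂ) :
    star v ⬝ᵥ (gramMatrix φ a b *ᵥ v) =
      ((∫ t in a..b, ‖(fun i => φ i t) ⬝ᵥ v‖ ^ 2 : ℝ) : ℂ) := by
  rw [← intervalIntegral.integral_ofReal]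
  have : ∀ t, ((‖(fun i => φ i t) ⬝ᵥ v‖ ^ 2 : ℝ) : ℂ)
      = ∑ i, ∑ j, star (v i) * ((star (φ i t) * φ j t) * v j) := by
    intro t
    push_cast
    rw [← Complex.conj_mul', dotProduct, map_sum, Finset.sum_mul_sum]
    refine Finset.sum_congr rfl fun i _ => Finset.sum_congr rfl fun j _ => ?_
    simp; ring
  simp_rw [this]
  have hc : ∀ i j, Continuous fun t => star (v i) * ((star (φ i t) * φ j t) * v j) :=
    fun i j => by fun_prop
  rw [intervalIntegral.integral_finsetSum fun i _ =>
    (continuous_finsetSum _ fun j _ => hc i j).intervalIntegrable _ _]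
  simp only [dotProduct, mulVec, gramMatrix, of_apply, Pi.star_apply]
  refine Finset.sum_congr rfl fun i _ => ?_
  rw [intervalIntegral.integral_finsetSum fun j _ => (hc i j).intervalIntegrable _ _, Finset.mul_sum]
  refine Finset.sum_congr rfl fun j _ => ?_
  rw [intervalIntegral.integral_const_mul, intervalIntegral.integral_mul_const]

lemma re_dotProduct_gramMatrix_add (hφ : ∀ i, Continuous (φ i)) (δ : ℝ) (v : ι → ℂ) :
    (star v ⬝ᵥ ((gramMatrix φ a b + (δ : ℂ) • (1 : Matrix ι ι ℂ)) *ᵥ v)).re =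
      (∫ t in a..b, ‖(fun i => φ i t) ⬝ᵥ v‖ ^ 2) + δ * ∑ i, ‖v i‖ ^ 2 := by
  rw [add_mulVec, dotProduct_add, dotProduct_gramMatrix hφ, smul_mulVec, one_mulVec,
    dotProduct_smul, Complex.add_re, Complex.ofReal_re, smul_eq_mul, Complex.re_ofReal_mul]
  congr 2
  simp only [dotProduct, Pi.star_apply, Complex.star_def, Complex.conj_mul']
  rw [Complex.re_sum]
  exact Finset.sum_congr rfl fun i _ => by norm_cast

/-- Repeated frequencies make the Gram matrix singular; adding `δ` times the identity keeps it
invertible, and `δ` later tends to `0`. -/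
lemma gramMatrix_add_posDef (hφ : ∀ i, Continuous (φ i)) (hab : a ≤ b) {δ : ℝ} (hδ : 0 < δ) :
    (gramMatrix φ a b + (δ : ℂ) • (1 : Matrix ι ι ℂ)).PosDef := by
  refine Matrix.PosDef.posSemidef_add ?_ (PosDef.one.smul (by exact_mod_cast hδ))
  refine .of_dotProduct_mulVec_nonneg gramMatrix_isHermitian fun v => ?_
  rw [dotProduct_gramMatrix hφ]
  exact_mod_cast intervalIntegral.integral_nonneg hab fun t _ => by positivity

/-- With `G = H - δ`, the trace is the dimension minus `δ tr H⁻¹`, and `tr H⁻¹ ≥ 0`. By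
`integral_kernelDiag` this bounds the integral of the kernel diagonal. -/
lemma trace_inv_mul_gramMatrix (hφ : ∀ i, Continuous (φ i)) (hab : a ≤ b) {δ : ℝ} (hδ : 0 < δ) :
    ((gramMatrix φ a b + (δ : ℂ) • (1 : Matrix ι ι ℂ))⁻¹ * gramMatrix φ a b).trace.re
      ≤ Fintype.card ι := by
  have hH := gramMatrix_add_posDef hφ hab hδ
  set H := gramMatrix φ a b + (δ : ℂ) • (1 : Matrix ι ι ℂ) with hHdef
  have hG : gramMatrix φ a b = H - (δ : ℂ) • 1 := by simp [hHdef]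
  rw [hG, mul_sub, Matrix.nonsing_inv_mul _ ((isUnit_iff_isUnit_det _).1 hH.isUnit), trace_sub,
    trace_one, mul_smul_comm, mul_one, trace_smul, smul_eq_mul, Complex.sub_re,
    Complex.re_ofReal_mul]
  have := (Complex.le_def.1 hH.inv.posSemidef.trace_nonneg).1
  simp only [Complex.zero_re] at this
  simp only [Complex.natCast_re]
  nlinarith

lemma integral_kernelDiag (hφ : ∀ i, Continuous (φ i)) (H : Matrix ι ι ℂ) :
    ∫ t in a..b, kernelDiag H (fun i => φ i t) = (H⁻¹ * gramMatrix φ a b).trace.re := by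
  have h1 : ∀ t, kernelDiag H (fun i => φ i t)
      = Complex.reCLM (∑ i, ∑ j, H⁻¹ i j * (star (φ j t) * φ i t)) := fun t => by
    simp [kernelDiag, trace, mul_apply, vecMulVec_apply]
  have hc : ∀ i j, Continuous fun t => H⁻¹ i j * (star (φ j t) * φ i t) :=
    fun i j => by fun_prop
  have hc' : ∀ i, Continuous fun t => ∑ j, H⁻¹ i j * (star (φ j t) * φ i t) :=
    fun i => continuous_finsetSum _ fun j _ => hc i j
  simp_rw [h1]
  rw [ContinuousLinearMap.intervalIntegral_comp_comm _ 
      ((continuous_finsetSum _ fun i _ => hc' i).intervalIntegrable _ _),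
    intervalIntegral.integral_finsetSum fun i _ => (hc' i).intervalIntegrable _ _]
  simp only [trace, diag_apply, mul_apply, gramMatrix, of_apply, Complex.reCLM_apply]
  congr 1
  refine Finset.sum_congr rfl fun i _ => ?_
  rw [intervalIntegral.integral_finsetSum fun j _ => (hc i j).intervalIntegrable _ _]
  exact Finset.sum_congr rfl fun j _ => intervalIntegral.integral_const_mul _ _

lemma continuous_kernelDiag (hφ : ∀ i, Continuous (φ i)) (H : Matrix ι ι ℂ) :
    Continuous fun t => kernelDiag H (fun i => φ i t) := by
  simp only [kernelDiag, trace, mul_apply, vecMulVec_apply, diag_apply, Pi.star_apply]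
  fun_prop

end Matrices

/-- Removes the regularization by letting `δ` tend to `0`. -/
lemma le_of_forall_pos_le_add_mul {a b c : ℝ} (h : ∀ δ : ℝ, 0 < δ → a ≤ b + δ * c) : a ≤ b := by
  have ht : Filter.Tendsto (fun δ : ℝ => b + δ * c) (nhdsWithin 0 (Ioi 0)) (nhds b) := by
    have : ContinuousWithinAt (fun δ : ℝ => b + δ * c) (Ioi 0) 0 := by fun_prop
    simpa [ContinuousWithinAt] using this
  exact ge_of_tendsto ht (Filter.eventually_of_mem self_mem_nhdsWithin h)

/-! ### Exponential sums: the interior bound and the Lyapunov identity. -/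

section ExpSum

open Matrix
open scoped ComplexOrder

variable {ι : Type*} [Fintype ι]

/-- The exponential sum `∑ j, v j * exp (μ j * t)`. -/
noncomputable def expSum (v μ : ι → ℂ) (t : ℝ) : ℂ := ∑ j, v j * Complex.exp (μ j * t)

lemma continuous_expSum (v μ : ι → ℂ) : Continuous (expSum v μ) := by
  unfold expSum; fun_prop

lemma expSum_eq_dotProduct (v μ : ι → ℂ) (t : ℝ) :
    expSum v μ t = (fun j => Complex.exp (μ j * t)) ⬝ᵥ v := by
  simp [expSum, dotProduct, mul_comm]

lemma expSum_add (v μ : ι → ℂ) (s t : ℝ) :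
    expSum v μ (s + t) = expSum (fun j => v j * Complex.exp (μ j * s)) μ t := by
  simp only [expSum, mul_assoc, ← Complex.exp_add]
  push_cast
  simp only [mul_add]

lemma norm_exp_mul_ofReal (z : ℂ) (t : ℝ) : ‖Complex.exp (z * t)‖ = rexp (z.re * t) := by
  rw [Complex.norm_exp, Complex.re_mul_ofReal]

lemma expSum_sub_const (v μ : ι → ℂ) (ε t : ℝ) :
    expSum v (fun j => μ j - ε) t = Complex.exp (-(ε * t)) * expSum v μ t := by
  simp only [expSum, Finset.mul_sum]
  refine Finset.sum_congr rfl fun j _ => ?_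
  rw [mul_left_comm, ← Complex.exp_add]
  ring_nf

/-- Averaging the reproducing kernel of `L²(0, r)` over translates: the value of an exponential sum
with `k` purely imaginary exponents at the midpoint of an interval is controlled by `k` times its
mean square. -/
theorem mul_norm_expSum_sq_le {v μ : ι → ℂ} (hμ : ∀ j, (μ j).re = 0) (x : ℝ) {r : ℝ} (hr : 0 ≤ r) :
    r * ‖expSum v μ x‖ ^ 2 ≤ Fintype.card ι * ∫ t in (x - r)..(x + r), ‖expSum v μ t‖ ^ 2 := by
  classical
  refine le_of_forall_pos_le_add_mul (c := Fintype.card ι * ∑ j, ‖v j‖ ^ 2) fun δ hδ => ?_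
  set φ : ι → ℝ → ℂ := fun j t => Complex.exp (μ j * t) with hφdef
  have hφ : ∀ j, Continuous (φ j) := fun j => by fun_prop
  have hc : Continuous fun t => ‖expSum v μ t‖ ^ 2 := ((continuous_expSum v μ).norm.pow 2)
  have hH := gramMatrix_add_posDef hφ hr hδ
  have htr := trace_inv_mul_gramMatrix hφ hr hδ
  set H := gramMatrix φ 0 r + (δ : ℂ) • (1 : Matrix ι ι ℂ) with hHdef
  set A := (∫ t in (x - r)..(x + r), ‖expSum v μ t‖ ^ 2) + δ * ∑ j, ‖v j‖ ^ 2 with hA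
  have hA0 : 0 ≤ A := by
    have : 0 ≤ ∫ t in (x - r)..(x + r), ‖expSum v μ t‖ ^ 2 :=
      intervalIntegral.integral_nonneg (by linarith) fun _ _ => by positivity
    positivity
  -- Place `x` at position `s` of the window `[x - s, x - s + r]`, which lies in `[x - r, x + r]`.
  -- Imaginary exponents leave the moduli of the translated coefficients, hence the `δ` term,
  -- unchanged.
  have key : ∀ s ∈ Icc 0 r, ‖expSum v μ x‖ ^ 2 ≤ kernelDiag H (fun j => φ j s) * A := by
    intro s hs
    have h1 := norm_dotProduct_sq_le_kernelDiag hH (fun j => φ j s)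
      (fun j => v j * Complex.exp (μ j * ((x - s : ℝ) : ℂ)))
    rw [hHdef, re_dotProduct_gramMatrix_add hφ, ← hHdef] at h1
    simp only [hφdef, ← expSum_eq_dotProduct, ← expSum_add, norm_mul, norm_exp_mul_ofReal, hμ,
      zero_mul, Real.exp_zero, mul_one, sub_add_cancel] at h1
    refine h1.trans (mul_le_mul_of_nonneg_left ?_ (kernelDiag_nonneg hH _))
    rw [hA]
    gcongr
    rw [intervalIntegral.integral_comp_add_left (fun t => ‖expSum v μ t‖ ^ 2)]
    exact intervalIntegral.integral_mono_interval (by linarith [hs.2]) (by linarith)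
      (by linarith [hs.1]) (Filter.Eventually.of_forall fun _ => by positivity)
      (hc.intervalIntegrable _ _)
  have h2 : ∫ _ in (0 : ℝ)..r, ‖expSum v μ x‖ ^ 2
      ≤ ∫ s in (0 : ℝ)..r, kernelDiag H (fun j => φ j s) * A :=
    intervalIntegral.integral_mono_on hr intervalIntegrable_const
      (((continuous_kernelDiag hφ H).mul continuous_const).intervalIntegrable _ _) key
  rw [intervalIntegral.integral_const, intervalIntegral.integral_mul_const,
    integral_kernelDiag hφ, smul_eq_mul, sub_zero] at h2
  calc _ ≤ _ := h2
    _ ≤ Fintype.card ι * A := mul_le_mul_of_nonneg_right htr hA0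
    _ = _ := by rw [hA]; ring

/-- Lyapunov identity: integrate the derivative of `star (φ i) * φ j`, which is `star (μ i) + μ j`
times the product itself. -/
lemma vecMulVec_exp_sub [DecidableEq ι] (μ : ι → ℂ) (a b : ℝ) :
    vecMulVec (star fun j => Complex.exp (μ j * b)) (fun j => Complex.exp (μ j * b))
      - vecMulVec (star fun j => Complex.exp (μ j * a)) (fun j => Complex.exp (μ j * a))
      = diagonal (star μ) * gramMatrix (fun j t => Complex.exp (μ j * t)) a b
        + gramMatrix (fun j t => Complex.exp (μ j * t)) a b * diagonal μ := by
  ext i j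
  have hexp : ∀ t : ℝ, star (Complex.exp (μ i * t)) * Complex.exp (μ j * t)
      = Complex.exp ((star (μ i) + μ j) * t) := fun t => by
    rw [Complex.star_def, ← Complex.exp_conj, ← Complex.exp_add]
    simp [add_mul]
  simp only [Matrix.sub_apply, vecMulVec_apply, Pi.star_apply, Matrix.add_apply, diagonal_mul, mul_diagonal,
    gramMatrix, of_apply, hexp]
  rw [mul_comm _ (μ j), ← add_mul, ← intervalIntegral.integral_const_mul,
    intervalIntegral.integral_eq_sub_of_hasDerivAt (f := fun t : ℝ =>
      Complex.exp ((star (μ i) + μ j) * t))]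
  · intro t _
    have h := (((hasDerivAt_id t).ofReal_comp).const_mul (star (μ i) + μ j)).cexp
    simpa [mul_comm] using h
  · exact Continuous.intervalIntegrable (by fun_prop) _ _

/-- Tracing the Lyapunov identity against `H⁻¹` turns the left side into the difference of the
kernel diagonals at `1` and `0`. On the right only the real parts `-ε` survive, giving `-2 ε (k - δ
tr H⁻¹)`. -/
lemma kernelDiag_zero_le [DecidableEq ι] {μ : ι → ℂ} {ε : ℝ} (hε : 0 ≤ ε)
    (hμ : ∀ j, (μ j).re = -ε) {δ : ℝ} (hδ : 0 < δ) :
    kernelDiag (gramMatrix (fun j t => Complex.exp (μ j * t)) 0 1 + (δ : ℂ) • (1 : Matrix ι ι ℂ))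
        (fun j => Complex.exp (μ j * (0 : ℝ)))
      ≤ 2 * ε * Fintype.card ι +
        kernelDiag (gramMatrix (fun j t => Complex.exp (μ j * t)) 0 1
          + (δ : ℂ) • (1 : Matrix ι ι ℂ)) (fun j => Complex.exp (μ j * (1 : ℝ))) := by
  set φ : ι → ℝ → ℂ := fun j t => Complex.exp (μ j * t) with hφdef
  have hφ : ∀ j, Continuous (φ j) := fun j => by fun_prop
  have hH := gramMatrix_add_posDef hφ zero_le_one hδ
  have hP := vecMulVec_exp_sub μ 0 1
  rw [← hφdef] at hP
  set G := gramMatrix φ 0 1 with hG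
  set H := G + (δ : ℂ) • (1 : Matrix ι ι ℂ) with hHdef
  have hGH : G = H - (δ : ℂ) • 1 := by simp [hHdef]
  have hu := (isUnit_iff_isUnit_det _).1 hH.isUnit
  have hD : diagonal (star μ) + diagonal μ = ((-2 * ε : ℝ) : ℂ) • (1 : Matrix ι ι ℂ) := by
    rw [diagonal_add, ← diagonal_one, ← diagonal_smul]
    congr 1
    ext j
    simp only [Pi.star_apply, Complex.star_def, Pi.smul_apply, smul_eq_mul, mul_one]
    rw [add_comm, Complex.add_conj, hμ]
    push_cast; ring
  have h1 : (H⁻¹ * (diagonal (star μ) * G + G * diagonal μ)).trace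
      = ((-2 * ε : ℝ) : ℂ) * (Fintype.card ι - δ * H⁻¹.trace) := by
    have e1 : (H⁻¹ * (diagonal (star μ) * G)).trace
        = (diagonal (star μ)).trace - δ * (H⁻¹ * diagonal (star μ)).trace := by
      rw [hGH, ← mul_assoc, mul_sub, trace_sub, trace_mul_cycle, Matrix.mul_nonsing_inv _ hu,
        one_mul, mul_smul_comm, mul_one, trace_smul, smul_eq_mul]
    have e2 : (H⁻¹ * (G * diagonal μ)).trace
        = (diagonal μ).trace - δ * (H⁻¹ * diagonal μ).trace := by
      rw [hGH, sub_mul, mul_sub, Matrix.nonsing_inv_mul_cancel_left _ _ hu, trace_sub,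
        smul_mul_assoc, one_mul, mul_smul_comm, trace_smul, smul_eq_mul]
    rw [mul_add, trace_add, e1, e2]
    calc _ = (diagonal (star μ) + diagonal μ).trace
          - δ * (H⁻¹ * (diagonal (star μ) + diagonal μ)).trace := by
          rw [mul_add, trace_add, trace_add]; ring
      _ = _ := by
          rw [hD, mul_smul_comm, mul_one, trace_smul, trace_smul, trace_one]
          simp only [smul_eq_mul]; ring
  have h2 := congrArg Complex.re h1
  rw [← hP, mul_sub, trace_sub, Complex.sub_re, Complex.re_ofReal_mul, Complex.sub_re,
    Complex.re_ofReal_mul, Complex.natCast_re] at h2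
  have h3 := (Complex.le_def.1 hH.inv.posSemidef.trace_nonneg).1
  simp only [Complex.zero_re] at h3
  unfold kernelDiag
  have : 0 ≤ ε * (δ * H⁻¹.trace.re) := by positivity
  linarith

/-- Transfers an evaluation bound from the endpoint `1` to the endpoint `0`, through the optimality
of the kernel diagonal at `1`. -/
lemma norm_expSum_zero_sq_le {μ : ι → ℂ} {ε B : ℝ} (hε : 0 ≤ ε) (hB : 0 ≤ B)
    (hμ : ∀ j, (μ j).re = -ε)
    (h : ∀ v : ι → ℂ, ‖expSum v μ 1‖ ^ 2 ≤ B * ∫ t in (0 : ℝ)..1, ‖expSum v μ t‖ ^ 2)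
    (v : ι → ℂ) :
    ‖expSum v μ 0‖ ^ 2
      ≤ (2 * ε * Fintype.card ι + B) * ∫ t in (0 : ℝ)..1, ‖expSum v μ t‖ ^ 2 := by
  classical
  refine le_of_forall_pos_le_add_mul
    (c := (2 * ε * Fintype.card ι + B) * ∑ j, ‖v j‖ ^ 2) fun δ hδ => ?_
  have h0 := kernelDiag_zero_le hε hμ hδ
  set φ : ι → ℝ → ℂ := fun j t => Complex.exp (μ j * t) with hφdef
  have hφ : ∀ j, Continuous (φ j) := fun j => by fun_prop
  have hH := gramMatrix_add_posDef hφ zero_le_one hδ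
  have hq := re_dotProduct_gramMatrix_add (a := 0) (b := 1) hφ δ
  simp only [hφdef, ← expSum_eq_dotProduct] at hq
  rw [← hφdef] at hq
  set H := gramMatrix φ 0 1 + (δ : ℂ) • (1 : Matrix ι ι ℂ) with hHdef
  have h1 : kernelDiag H (fun j => Complex.exp (μ j * (1 : ℝ))) ≤ B := by
    refine kernelDiag_le hH _ hB fun w => ?_
    rw [← expSum_eq_dotProduct, hq]
    refine (h w).trans (mul_le_mul_of_nonneg_left (le_add_of_nonneg_right (by positivity)) hB)
  have h2 := norm_dotProduct_sq_le_kernelDiag hH (fun j => Complex.exp (μ j * (0 : ℝ))) v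
  rw [← expSum_eq_dotProduct, hq] at h2
  have h3 : 0 ≤ ∫ t in (0 : ℝ)..1, ‖expSum v μ t‖ ^ 2 :=
    intervalIntegral.integral_nonneg zero_le_one fun _ _ => by positivity
  calc _ ≤ _ := h2
    _ ≤ (2 * ε * Fintype.card ι + B) *
        ((∫ t in (0 : ℝ)..1, ‖expSum v μ t‖ ^ 2) + δ * ∑ j, ‖v j‖ ^ 2) :=
      mul_le_mul_of_nonneg_right (by linarith) (by positivity)
    _ = _ := by ring

end ExpSum

/-! ### Growth along arithmetic progressions and the endpoint bound. -/

/-- Samples with step `h` satisfy the linear recurrence with characteristic polynomial `∏ (X - exp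
(μ j h))`. Its roots are unimodular, so its non-leading coefficients have moduli summing to at most
`2 ^ k - 1`. -/
lemma norm_expSum_le_of_prev {k : ℕ} {μ : Fin k → ℂ} (hμ : ∀ j, (μ j).re = 0) (v : Fin k → ℂ)
    {x h M : ℝ} (hM : ∀ j : ℕ, j < k → ‖expSum v μ (x - (j + 1) * h)‖ ≤ M) :
    ‖expSum v μ x‖ ≤ (2 ^ k - 1) * M := by
  induction k generalizing M with
  | zero => simp [expSum]
  | succ k ih =>
    -- The twisted difference `f y - exp (μ 0 h) f (y - h)` kills the exponent `μ 0` and at most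
    -- doubles the bound `M`.
    set w : Fin k → ℂ := fun j => v j.succ * (1 - Complex.exp ((μ 0 - μ j.succ) * h)) with hw
    have hdiff : ∀ y : ℝ, expSum w (fun j => μ j.succ) y
        = expSum v μ y - Complex.exp (μ 0 * h) * expSum v μ (y - h) := by
      intro y
      simp only [expSum, Finset.mul_sum, ← Finset.sum_sub_distrib, hw]
      rw [Fin.sum_univ_succ (n := k)]
      have e : ∀ i, Complex.exp (μ 0 * h) * (v i * Complex.exp (μ i * (y - h : ℝ)))
          = v i * Complex.exp ((μ 0 - μ i) * h) * Complex.exp (μ i * y) := fun i => by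
        rw [mul_left_comm, ← Complex.exp_add, mul_assoc, ← Complex.exp_add]
        congr 2
        push_cast; ring
      simp only [e, sub_self, zero_mul, Complex.exp_zero, mul_one, zero_add]
      exact Finset.sum_congr rfl fun i _ => by ring
    have hz : ‖Complex.exp (μ 0 * h)‖ = 1 := by simp [norm_exp_mul_ofReal, hμ]
    have h1 : ‖expSum w (fun j => μ j.succ) x‖ ≤ (2 ^ k - 1) * (2 * M) := by
      refine ih (fun j => hμ _) _ fun j hj => ?_
      rw [hdiff]
      refine (norm_sub_le _ _).trans ?_
      rw [norm_mul, hz, one_mul, two_mul]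
      refine add_le_add (hM j (by omega)) ?_
      have := hM (j + 1) (by omega)
      rwa [show x - (((j + 1 : ℕ) : ℝ) + 1) * h = x - (j + 1) * h - h by push_cast; ring] at this
    have h2 : expSum v μ x = expSum w (fun j => μ j.succ) x
        + Complex.exp (μ 0 * h) * expSum v μ (x - h) := by rw [hdiff, sub_add_cancel]
    have h3 := hM 0 (by omega)
    norm_num at h3
    rw [h2]
    refine (norm_add_le _ _).trans ?_
    rw [norm_mul, hz, one_mul, pow_succ]
    linarith

lemma norm_expSum_arith_le {k : ℕ} {μ : Fin k → ℂ} (hμ : ∀ j, (μ j).re = 0) (v : Fin k → ℂ)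
    {a h M : ℝ} (hM0 : 0 ≤ M) (hM : ∀ j : ℕ, j < k → ‖expSum v μ (a + j * h)‖ ≤ M) (n : ℕ) :
    ‖expSum v μ (a + n * h)‖ ≤ 2 ^ (k * n) * M := by
  induction n using Nat.strong_induction_on with
  | _ n ih =>
    rcases lt_or_ge n k with hn | hn
    · exact (hM n hn).trans (le_mul_of_one_le_left hM0 (one_le_pow₀ one_le_two))
    -- The bound below involves `n - 1`, so `n = 0` is separated; it forces `k = 0` and an empty
    -- sum.
    · rcases Nat.eq_zero_or_pos n with rfl | hn0
      · have : k = 0 := by omega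
        subst this
        simpa [expSum] using hM0
      have h1 : ‖expSum v μ (a + n * h)‖ ≤ (2 ^ k - 1) * (2 ^ (k * (n - 1)) * M) := by
        refine norm_expSum_le_of_prev hμ v (h := h) fun j hj => ?_
        have := ih (n - (j + 1)) (by omega)
        rw [Nat.cast_sub (by omega)] at this
        push_cast at this
        rw [show a + n * h - (j + 1) * h = a + (n - (j + 1)) * h by ring]
        refine this.trans (mul_le_mul_of_nonneg_right (pow_le_pow_right₀ one_le_two ?_) hM0)
        exact Nat.mul_le_mul_left _ (by omega)
      refine h1.trans ?_
      have h2 : (2 : ℝ) ^ (k * n) = 2 ^ k * 2 ^ (k * (n - 1)) := by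
        rw [← pow_add]
        congr 1
        obtain ⟨m, rfl⟩ : ∃ m, n = m + 1 := ⟨n - 1, by omega⟩
        simp; ring
      rw [h2, mul_assoc]
      exact mul_le_mul_of_nonneg_right (by linarith) (by positivity)

lemma norm_expSum_one_sq_le {k : ℕ} (hk : 1 ≤ k) {μ : Fin k → ℂ} (hμ : ∀ j, (μ j).re = 0)
    (v : Fin k → ℂ) :
    ‖expSum v μ 1‖ ^ 2
      ≤ 4 ^ (4 * k ^ 2) * (8 * k * ∫ t in (0 : ℝ)..(1 / 2), ‖expSum v μ t‖ ^ 2) := by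
  have hk' : (1 : ℝ) ≤ k := by exact_mod_cast hk
  set I := ∫ t in (0 : ℝ)..(1 / 2), ‖expSum v μ t‖ ^ 2 with hI
  have hI0 : 0 ≤ I := intervalIntegral.integral_nonneg (by norm_num) fun _ _ => by positivity
  have hc : Continuous fun t => ‖expSum v μ t‖ ^ 2 := (continuous_expSum v μ).norm.pow 2
  have hmid : ∀ x ∈ Icc (1 / 8 : ℝ) (3 / 8), ‖expSum v μ x‖ ≤ √(8 * k * I) := by
    intro x hx
    refine Real.le_sqrt_of_sq_le ?_
    have h1 := mul_norm_expSum_sq_le (v := v) hμ x (r := 1 / 8) (by norm_num)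
    have h2 : ∫ t in (x - 1 / 8)..(x + 1 / 8), ‖expSum v μ t‖ ^ 2 ≤ I :=
      intervalIntegral.integral_mono_interval (by linarith [hx.1]) (by linarith)
        (by linarith [hx.2]) (Filter.Eventually.of_forall fun _ => by positivity)
        (hc.intervalIntegrable _ _)
    rw [Fintype.card_fin] at h1
    have h3 := mul_le_mul_of_nonneg_left h2 (Nat.cast_nonneg (α := ℝ) k)
    linarith
  -- The first `k` nodes stay in `[1/8, 1/8 + 7/32]`, inside `[1/8, 3/8]`, where the interior bound
  -- with `r = 1/8` applies; node number `4k` is exactly `1`.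
  have h1 := norm_expSum_arith_le hμ v (a := 1 / 8) (h := 7 / (32 * k)) (Real.sqrt_nonneg _)
    (fun j hj => hmid _ ?_) (4 * k)
  · have e : (1 / 8 : ℝ) + ((4 * k : ℕ) : ℝ) * (7 / (32 * k)) = 1 := by
      push_cast; field_simp; norm_num
    rw [e] at h1
    have h2 := pow_le_pow_left₀ (norm_nonneg _) h1 2
    rw [mul_pow, Real.sq_sqrt (by positivity)] at h2
    refine h2.trans_eq ?_
    rw [show (4 : ℝ) = 2 ^ 2 by norm_num, ← pow_mul, ← pow_mul]
    congr 2
    ring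
  · have hj' : (j : ℝ) ≤ k := by exact_mod_cast hj.le
    have : (j : ℝ) * (7 / (32 * k)) ≤ 7 / 32 := by
      rw [mul_div_assoc', div_le_div_iff₀ (by positivity) (by norm_num)]
      linarith
    constructor
    · have : 0 ≤ (j : ℝ) * (7 / (32 * k)) := by positivity
      linarith
    · linarith

theorem norm_expSum_left_endpoint_sq_le {k : ℕ} (hk : 1 ≤ k) {μ : Fin k → ℂ}
    (hμ : ∀ j, (μ j).re = 0) (v : Fin k → ℂ) :
    ‖expSum v μ 0‖ ^ 2 ≤ 24 * k ^ 3 * ∫ t in (0 : ℝ)..1, ‖expSum v μ t‖ ^ 2 := by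
  have hk' : (1 : ℝ) ≤ k := by exact_mod_cast hk
  -- The squared tilt is `exp (-2ε)` at `1` and at least `exp (-ε)` on `[0, 1/2]`. The gain `exp
  -- (-ε)` absorbs `4 ^ (4 k²) = 2 ^ (8 k²)` because `2 ≤ e`.
  set ε : ℝ := 8 * k ^ 2 with hε
  have hε0 : 0 ≤ ε := by positivity
  have hnorm : ∀ (w : Fin k → ℂ) (t : ℝ), ‖expSum w (fun j => μ j - ε) t‖ ^ 2
      = rexp (-(2 * ε * t)) * ‖expSum w μ t‖ ^ 2 := by
    intro w t
    rw [expSum_sub_const, norm_mul, mul_pow, Complex.norm_exp, ← Real.exp_nat_mul]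
    congr 2
    norm_cast
    simp; ring
  have hc : ∀ w : Fin k → ℂ, Continuous fun t => ‖expSum w μ t‖ ^ 2 := fun w =>
    (continuous_expSum w μ).norm.pow 2
  have hc' : ∀ w : Fin k → ℂ, Continuous fun t => ‖expSum w (fun j => μ j - ε) t‖ ^ 2 := fun w =>
    (continuous_expSum w _).norm.pow 2
  have hB : ∀ w : Fin k → ℂ, ‖expSum w (fun j => μ j - ε) 1‖ ^ 2
      ≤ 8 * k * ∫ t in (0 : ℝ)..1, ‖expSum w (fun j => μ j - ε) t‖ ^ 2 := by
    intro w
    set J := ∫ t in (0 : ℝ)..1, ‖expSum w (fun j => μ j - ε) t‖ ^ 2 with hJ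
    have hJ0 : 0 ≤ J := intervalIntegral.integral_nonneg zero_le_one fun _ _ => by positivity
    have h1 := norm_expSum_one_sq_le hk hμ w
    have h2 : ∫ t in (0 : ℝ)..(1 / 2), ‖expSum w μ t‖ ^ 2 ≤ rexp ε * J := by
      calc _ ≤ ∫ t in (0 : ℝ)..(1 / 2), rexp ε * ‖expSum w (fun j => μ j - ε) t‖ ^ 2 := by
            refine intervalIntegral.integral_mono_on (by norm_num)
              ((hc w).intervalIntegrable _ _)
              ((continuous_const.mul (hc' w)).intervalIntegrable _ _) fun t ht => ?_
            rw [hnorm, ← mul_assoc, ← Real.exp_add]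
            refine le_mul_of_one_le_left (by positivity) (Real.one_le_exp ?_)
            nlinarith [ht.2]
        _ = rexp ε * ∫ t in (0 : ℝ)..(1 / 2), ‖expSum w (fun j => μ j - ε) t‖ ^ 2 := by
            rw [intervalIntegral.integral_const_mul]
        _ ≤ rexp ε * J := by
            gcongr
            exact intervalIntegral.integral_mono_interval le_rfl (by norm_num) (by norm_num)
              (Filter.Eventually.of_forall fun _ => by positivity)
              ((hc' w).intervalIntegrable _ _)
    have h4 : (4 : ℝ) ^ (4 * k ^ 2) ≤ rexp ε := by
      have h2e : (2 : ℝ) ≤ rexp 1 := by have := Real.add_one_le_exp 1; linarith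
      calc (4 : ℝ) ^ (4 * k ^ 2) = 2 ^ (8 * k ^ 2) := by
            rw [show (4 : ℝ) = 2 ^ 2 by norm_num, ← pow_mul]; congr 1; ring
        _ ≤ rexp 1 ^ (8 * k ^ 2) := by gcongr
        _ = rexp ε := by rw [← Real.exp_nat_mul, hε]; push_cast; ring_nf
    rw [hnorm]
    calc rexp (-(2 * ε * 1)) * ‖expSum w μ 1‖ ^ 2
        ≤ rexp (-(2 * ε * 1)) * (rexp ε * (8 * k * (rexp ε * J))) := by
          refine mul_le_mul_of_nonneg_left (h1.trans ?_) (Real.exp_pos _).le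
          have : 0 ≤ ∫ t in (0 : ℝ)..(1 / 2), ‖expSum w μ t‖ ^ 2 :=
            intervalIntegral.integral_nonneg (by norm_num) fun _ _ => by positivity
          gcongr
      _ = (rexp (-(2 * ε * 1)) * rexp ε * rexp ε) * (8 * k * J) := by ring
      _ = 8 * k * J := by
          rw [← Real.exp_add, ← Real.exp_add]
          ring_nf
          simp
  have h := norm_expSum_zero_sq_le hε0 (by positivity) (fun j => by simp [hμ]) hB v
  rw [hnorm, Fintype.card_fin] at h
  simp only [mul_zero, neg_zero, Real.exp_zero, one_mul] at h
  have hle : ∫ t in (0 : ℝ)..1, ‖expSum v (fun j => μ j - ε) t‖ ^ 2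
      ≤ ∫ t in (0 : ℝ)..1, ‖expSum v μ t‖ ^ 2 := by
    refine intervalIntegral.integral_mono_on zero_le_one ((hc' v).intervalIntegrable _ _)
      ((hc v).intervalIntegrable _ _) fun t ht => ?_
    rw [hnorm]
    refine mul_le_of_le_one_left (by positivity) (Real.exp_le_one_iff.2 ?_)
    have := ht.1
    have : 0 ≤ 2 * ε * t := by positivity
    linarith
  have h0 : 0 ≤ ∫ t in (0 : ℝ)..1, ‖expSum v μ t‖ ^ 2 :=
    intervalIntegral.integral_nonneg zero_le_one fun _ _ => by positivity
  calc _ ≤ _ := h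
    -- The tilt equals `1` at `0` and only decreases the integral, so it can be dropped. The
    -- constant is `16 k³ + 8 k ≤ 24 k³`.
    _ ≤ (2 * ε * k + 8 * k) * ∫ t in (0 : ℝ)..1, ‖expSum v μ t‖ ^ 2 := by gcongr
    _ ≤ _ := by
      refine mul_le_mul_of_nonneg_right ?_ h0
      have : (k : ℝ) ≤ k ^ 3 := le_self_pow₀ hk' (by norm_num)
      rw [hε]
      nlinarith

/-! ### Pointwise bounds for Fourier-sparse signals on `[-1, 1]`. -/

section FourierSparse

lemma normSqD_eq {f : ℝ → ℂ} : normSqD f = (∫ t in (-1 : ℝ)..1, ‖f t‖ ^ 2) / 2 := by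
  unfold normSqD uniformMeasure densityMeasure uniformDensity
  rw [withDensity_const, integral_smul_measure, intervalIntegral.integral_of_le (by norm_num),
    integral_Icc_eq_integral_Ioc, ENNReal.toReal_ofReal (by norm_num), smul_eq_mul]
  ring

lemma exists_expSum_of_mem_fourierSparse {k : ℕ} {F : ℝ} {f : ℝ → ℂ}
    (hf : f ∈ fourierSparse k F) :
    ∃ v μ : Fin k → ℂ, (∀ j, (μ j).re = 0) ∧ f = expSum v μ := by
  obtain ⟨v, ξ, -, h⟩ := hf
  exact ⟨v, fun j => 2 * π * Complex.I * ξ j, fun j => by simp, funext h⟩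

lemma one_sub_abs_mul_norm_sq_le {k : ℕ} {F : ℝ} {f : ℝ → ℂ} (hf : f ∈ fourierSparse k F) {x : ℝ}
    (hx : |x| ≤ 1) : (1 - |x|) * ‖f x‖ ^ 2 ≤ 2 * k * normSqD f := by
  obtain ⟨v, μ, hμ, rfl⟩ := exists_expSum_of_mem_fourierSparse hf
  have h := mul_norm_expSum_sq_le (v := v) hμ x (sub_nonneg.2 hx)
  rw [Fintype.card_fin] at h
  have h1 : ∫ t in (x - (1 - |x|))..(x + (1 - |x|)), ‖expSum v μ t‖ ^ 2
      ≤ ∫ t in (-1 : ℝ)..1, ‖expSum v μ t‖ ^ 2 :=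
    intervalIntegral.integral_mono_interval (by linarith [neg_abs_le x]) (by linarith)
      (by linarith [le_abs_self x]) (Filter.Eventually.of_forall fun _ => by positivity)
      (((continuous_expSum v μ).norm.pow 2).intervalIntegrable _ _)
  have h2 := mul_le_mul_of_nonneg_left h1 (Nat.cast_nonneg (α := ℝ) k)
  rw [normSqD_eq]
  linarith

lemma norm_expSum_sq_le_integral_right {k : ℕ} (hk : 1 ≤ k) {v μ : Fin k → ℂ}
    (hμ : ∀ j, (μ j).re = 0) (x : ℝ) :
    ‖expSum v μ x‖ ^ 2 ≤ 24 * k ^ 3 * ∫ t in x..(x + 1), ‖expSum v μ t‖ ^ 2 := by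
  have h := norm_expSum_left_endpoint_sq_le hk hμ (fun j => v j * Complex.exp (μ j * x))
  simp only [← expSum_add] at h
  rwa [intervalIntegral.integral_comp_add_left (fun t => ‖expSum v μ t‖ ^ 2), add_zero] at h

lemma norm_sq_le_cube_mul_normSqD {k : ℕ} (hk : 1 ≤ k) {F : ℝ} {f : ℝ → ℂ}
    (hf : f ∈ fourierSparse k F) {x : ℝ} (hx : |x| ≤ 1) :
    ‖f x‖ ^ 2 ≤ 48 * k ^ 3 * normSqD f := by
  obtain ⟨v, μ, hμ, rfl⟩ := exists_expSum_of_mem_fourierSparse hf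
  rw [normSqD_eq]
  obtain ⟨hx1, hx2⟩ := abs_le.1 hx
  have hint := ((continuous_expSum v μ).norm.pow 2).intervalIntegrable (μ := volume) (-1) 1
  have hpos : 0 ≤ᵐ[volume.restrict (Ioc (-1) 1)] fun t => ‖expSum v μ t‖ ^ 2 :=
    Filter.Eventually.of_forall fun _ => by positivity
  suffices h : ‖expSum v μ x‖ ^ 2 ≤ 24 * k ^ 3 * ∫ t in (-1 : ℝ)..1, ‖expSum v μ t‖ ^ 2 by
    linarith
  -- A unit interval with endpoint `x` fits in `[-1, 1]` on the side towards the origin; for `x ≥ 0`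
  -- reflect by `μ ↦ -μ`.
  rcases le_total x 0 with h0 | h0
  · refine (norm_expSum_sq_le_integral_right hk hμ x).trans ?_
    gcongr
    exact intervalIntegral.integral_mono_interval hx1 (by linarith) (by linarith) hpos hint
  · have hneg : ∀ t, expSum v (fun j => -μ j) t = expSum v μ (-t) := fun t => by simp [expSum]
    have h := norm_expSum_sq_le_integral_right hk (v := v) (μ := fun j => -μ j)
      (fun j => by simp [hμ]) (-x)
    simp only [hneg] at h
    rw [intervalIntegral.integral_comp_neg (fun t => ‖expSum v μ t‖ ^ 2), neg_neg] at h
    refine h.trans ?_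
    gcongr
    exact intervalIntegral.integral_mono_interval (by linarith) (by linarith) hx2 hpos hint

end FourierSparse

/-! ### The sampling density and the condition numbers. -/

section Density

lemma normSqD_nonneg (f : ℝ → ℂ) : 0 ≤ normSqD f := by
  unfold normSqD; positivity

/-- The distance from the endpoints at which the sampling density becomes constant. -/
noncomputable def edgeWidth (k : ℕ) : ℝ := 1 / ((k : ℝ) ^ 3 * Real.log k ^ 2)

/-- The total mass of the unnormalized sampling density. -/
noncomputable def sparseMass (k : ℕ) : ℝ := 2 * (1 - Real.log (edgeWidth k)) / Real.log k

variable {k : ℕ}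

lemma log_natCast_ge (hk : 2 ≤ k) : 0.69 ≤ Real.log k := by
  have h := Real.log_le_log (by norm_num) (show (2 : ℝ) ≤ k by exact_mod_cast hk)
  have := Real.log_two_gt_d9
  linarith

lemma one_le_mul_log (hk : 2 ≤ k) : 1 ≤ k * Real.log k := by
  have h := log_natCast_ge hk
  have h2 : (2 : ℝ) ≤ k := by exact_mod_cast hk
  nlinarith

lemma le_cube_mul_log_sq (hk : 2 ≤ k) : (k : ℝ) ≤ (k : ℝ) ^ 3 * Real.log k ^ 2 := by
  have h := one_le_mul_log hk
  have h2 : (2 : ℝ) ≤ k := by exact_mod_cast hk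
  have h3 : 1 ≤ (k * Real.log k) ^ 2 := one_le_pow₀ h
  nlinarith

lemma edgeWidth_pos (hk : 2 ≤ k) : 0 < edgeWidth k := by
  have h := le_cube_mul_log_sq hk
  have h2 : (2 : ℝ) ≤ k := by exact_mod_cast hk
  exact one_div_pos.2 (by linarith)

lemma edgeWidth_le_half (hk : 2 ≤ k) : edgeWidth k ≤ 1 / 2 := by
  have h := le_cube_mul_log_sq hk
  have h2 : (2 : ℝ) ≤ k := by exact_mod_cast hk
  exact one_div_le_one_div_of_le (by norm_num) (by linarith)

/-- From `k ≤ k³ log² k ≤ k⁵`, minus the logarithm of the edge width lies between `log k` and `5 log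
k`. -/
lemma sparseMass_mem_Icc (hk : 2 ≤ k) : sparseMass k ∈ Icc (2 : ℝ) 14 := by
  have hl := log_natCast_ge hk
  have h2 : (2 : ℝ) ≤ k := by exact_mod_cast hk
  have hl0 : 0 < Real.log k := by linarith
  have h := le_cube_mul_log_sq hk
  have e : Real.log (edgeWidth k) = -Real.log ((k : ℝ) ^ 3 * Real.log k ^ 2) := by
    rw [edgeWidth, one_div, Real.log_inv]
  have hlow := Real.log_le_log (by linarith) h
  have hhigh : Real.log ((k : ℝ) ^ 3 * Real.log k ^ 2) ≤ 5 * Real.log k := by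
    rw [show 5 * Real.log k = Real.log ((k : ℝ) ^ 5) by rw [Real.log_pow]; norm_num]
    refine Real.log_le_log (by linarith) ?_
    have : Real.log k ≤ k := (Real.log_le_sub_one_of_pos (by linarith)).trans (by linarith)
    calc (k : ℝ) ^ 3 * Real.log k ^ 2 ≤ (k : ℝ) ^ 3 * (k : ℝ) ^ 2 := by gcongr
      _ = (k : ℝ) ^ 5 := by ring
  rw [sparseMass, e]
  constructor
  · rw [le_div_iff₀ hl0]; linarith
  · rw [div_le_iff₀ hl0]; linarith

lemma sparseDensity_of_le {c x : ℝ} (hx : |x| ≤ 1 - edgeWidth k) :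
    sparseDensity k c x = c / ((1 - |x|) * Real.log k) := if_pos hx

lemma sparseDensity_of_lt {c x : ℝ} (hx : 1 - edgeWidth k < |x|) :
    sparseDensity k c x = c * (k : ℝ) ^ 3 * Real.log k := if_neg hx.not_ge

lemma sparseDensity_neg (c x : ℝ) : sparseDensity k c (-x) = sparseDensity k c x := by
  simp [sparseDensity]

lemma sparseDensity_pos (hk : 2 ≤ k) {c : ℝ} (hc : 0 < c) (x : ℝ) : 0 < sparseDensity k c x := by
  have hl := log_natCast_ge hk
  have h2 : (2 : ℝ) ≤ k := by exact_mod_cast hk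
  rcases le_or_gt |x| (1 - edgeWidth k) with h | h
  · rw [sparseDensity_of_le h]
    have := edgeWidth_pos hk
    exact div_pos hc (mul_pos (by linarith) (by linarith))
  · rw [sparseDensity_of_lt h]
    have : 0 < Real.log k := by linarith
    positivity

lemma measurable_sparseDensity (c : ℝ) : Measurable (sparseDensity k c) := by
  unfold sparseDensity
  refine Measurable.ite (measurableSet_le measurable_norm measurable_const) ?_ measurable_const
  exact measurable_const.div ((measurable_const.sub measurable_norm).mul measurable_const)

lemma hasIntegral_sparseDensity_zero_one (hk : 2 ≤ k) (c : ℝ) :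
    IntervalIntegrable (sparseDensity k c) volume 0 1 ∧
      ∫ x in (0 : ℝ)..1, sparseDensity k c x = c * sparseMass k / 2 := by
  have hl := log_natCast_ge hk
  have hl0 : Real.log k ≠ 0 := by linarith
  have hη := edgeWidth_pos hk
  have hη' := edgeWidth_le_half hk
  set η := edgeWidth k with hηdef
  have h1 : EqOn (sparseDensity k c) (fun x => (c / Real.log k) * (1 - x)⁻¹) (Icc 0 (1 - η)) := by
    intro x hx
    rw [sparseDensity_of_le (by rw [abs_of_nonneg hx.1]; exact hx.2), abs_of_nonneg hx.1]
    field_simp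
  have h2 : EqOn (sparseDensity k c) (fun _ => c * (k : ℝ) ^ 3 * Real.log k) (Ioc (1 - η) 1) := by
    intro x hx
    exact sparseDensity_of_lt (by rw [abs_of_pos (by linarith [hx.1])]; exact hx.1)
  have i1 : IntervalIntegrable (fun x : ℝ => (c / Real.log k) * (1 - x)⁻¹) volume 0 (1 - η) := by
    refine ContinuousOn.intervalIntegrable ?_
    rw [uIcc_of_le (by linarith)]
    exact continuousOn_const.mul ((continuousOn_const.sub continuousOn_id).inv₀ fun x hx => by
      have : x ≤ 1 - η := hx.2
      exact (by linarith : (0 : ℝ) < 1 - x).ne')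
  have i1' : IntervalIntegrable (sparseDensity k c) volume 0 (1 - η) :=
    i1.congr (by
      rw [uIoc_of_le (by linarith)]
      exact fun x hx => (h1 ⟨hx.1.le, hx.2⟩).symm)
  have i2' : IntervalIntegrable (sparseDensity k c) volume (1 - η) 1 :=
    (intervalIntegrable_const (c := c * (k : ℝ) ^ 3 * Real.log k)).congr (by
      rw [uIoc_of_le (by linarith)]
      exact fun x hx => (h2 hx).symm)
  refine ⟨i1'.trans i2', ?_⟩
  rw [← intervalIntegral.integral_add_adjacent_intervals i1' i2',
    intervalIntegral.integral_congr (g := fun x => (c / Real.log k) * (1 - x)⁻¹)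
      (by rwa [uIcc_of_le (by linarith)]),
    intervalIntegral.integral_of_le (by linarith : 1 - η ≤ 1),
    setIntegral_congr_fun measurableSet_Ioc h2,
    ← intervalIntegral.integral_of_le (by linarith : 1 - η ≤ 1),
    intervalIntegral.integral_const, intervalIntegral.integral_const_mul,
    intervalIntegral.integral_comp_sub_left (fun x => x⁻¹), sub_sub_cancel, sub_zero,
    integral_inv_of_pos hη one_pos, one_div, Real.log_inv, smul_eq_mul, sparseMass]
  have hk0 : (k : ℝ) ≠ 0 := by
    have : (2 : ℝ) ≤ k := by exact_mod_cast hk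
    linarith
  -- The edge width is exactly what makes the constant piece contribute `c / log k`.
  have e : η * (c * (k : ℝ) ^ 3 * Real.log k) = c / Real.log k := by
    rw [hηdef, edgeWidth]; field_simp
  rw [e, ← hηdef]
  field_simp
  ring

lemma isProbabilityMeasure_sparseDensity (hk : 2 ≤ k) :
    IsProbabilityMeasure (densityMeasure (sparseDensity k (sparseMass k)⁻¹)) := by
  have hm := (sparseMass_mem_Icc hk).1
  set c := (sparseMass k)⁻¹ with hc
  have hc0 : 0 < c := inv_pos.2 (by linarith)
  obtain ⟨hi, hI⟩ := hasIntegral_sparseDensity_zero_one hk c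
  have hneg : (fun x => sparseDensity k c (-x)) = sparseDensity k c :=
    funext (sparseDensity_neg c)
  have hi' : IntervalIntegrable (sparseDensity k c) volume (-1) 0 := by
    have := (IntervalIntegrable.iff_comp_neg (by finiteness)).1 hi
    rw [hneg, neg_zero] at this
    exact this.symm
  have hI' : ∫ x in (-1 : ℝ)..0, sparseDensity k c x = c * sparseMass k / 2 := by
    rw [← hI, ← hneg, intervalIntegral.integral_comp_neg, hneg]
    simp
  have htot : ∫ x in (-1 : ℝ)..1, sparseDensity k c x = 1 := by
    rw [← intervalIntegral.integral_add_adjacent_intervals hi' hi, hI, hI', hc]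
    field_simp
    norm_num
  refine ⟨?_⟩
  rw [densityMeasure, withDensity_apply _ MeasurableSet.univ, Measure.restrict_univ,
    ← Measure.restrict_congr_set Ioc_ae_eq_Icc, ← ofReal_integral_eq_lintegral_ofReal,
    ← intervalIntegral.integral_of_le (by norm_num), htot, ENNReal.ofReal_one]
  · exact (intervalIntegrable_iff_integrableOn_Ioc_of_le (by norm_num)).1 (hi'.trans hi)
  · exact Filter.Eventually.of_forall fun x => (sparseDensity_pos hk hc0 x).le

/-- The interior bound serves the first branch of the density and the cubic bound the second. They
give `14 k log k` and `336 / log k` times the squared norm, so `k log² k` leaves room. -/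
lemma norm_sq_mul_density_ratio_le (hk : 2 ≤ k) {c : ℝ} (hc : 1 / 14 ≤ c) {F : ℝ} {f : ℝ → ℂ}
    (hf : f ∈ fourierSparse k F) {x : ℝ} (hx : x ∈ Icc (-1 : ℝ) 1) :
    ‖f x‖ ^ 2 * (uniformDensity x / sparseDensity k c x)
      ≤ 1000 * (k * Real.log k ^ 2) * normSqD f := by
  have hx' : |x| ≤ 1 := abs_le.2 hx
  have hN := normSqD_nonneg f
  have hl := log_natCast_ge hk
  have hl0 : 0 < Real.log k := by linarith
  have h2 : (2 : ℝ) ≤ k := by exact_mod_cast hk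
  have hc0 : 0 < c := by linarith
  have hinv : 1 / c ≤ 14 := by rw [div_le_iff₀ hc0]; linarith
  rcases le_or_gt |x| (1 - edgeWidth k) with h | h
  · have h1 := one_sub_abs_mul_norm_sq_le hf hx'
    have hpos : 0 < 1 - |x| := by linarith [edgeWidth_pos hk]
    rw [sparseDensity_of_le h, uniformDensity]
    calc _ = (1 / c) * (((1 - |x|) * ‖f x‖ ^ 2) * (Real.log k / 2)) := by field_simp
      _ ≤ 14 * ((2 * k * normSqD f) * (Real.log k / 2)) := by gcongr
      _ = 14 * (k * normSqD f * Real.log k) * 1 := by ring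
      -- A factor `log k` is given away here, using `log k ≥ 0.69 > 1/2`.
      _ ≤ 14 * (k * normSqD f * Real.log k) * (2 * Real.log k) := by gcongr; linarith
      _ = 28 * (k * normSqD f * Real.log k ^ 2) := by ring
      _ ≤ 1000 * (k * normSqD f * Real.log k ^ 2) := by gcongr; norm_num
      _ = _ := by ring
  · have h1 := norm_sq_le_cube_mul_normSqD (by omega : 1 ≤ k) hf hx'
    rw [sparseDensity_of_lt h, uniformDensity]
    calc _ = (1 / c) * (‖f x‖ ^ 2 * (1 / (2 * k ^ 3 * Real.log k))) := by field_simp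
      _ ≤ 14 * ((48 * k ^ 3 * normSqD f) * (1 / (2 * k ^ 3 * Real.log k))) := by gcongr
      _ = 336 * normSqD f * (1 / Real.log k) := by field_simp; ring
      _ ≤ 336 * normSqD f * (2 * (k * Real.log k ^ 2)) := by
        gcongr
        rw [div_le_iff₀ hl0]
        have : 0.69 ^ 3 ≤ Real.log k ^ 3 := by gcongr
        nlinarith
      _ ≤ 1000 * (k * Real.log k ^ 2) * normSqD f := by
        have : 0 ≤ normSqD f * (k * Real.log k ^ 2) := by positivity
        linarith

lemma ofReal_density_ratio_mul_supRatio_le {𝓕 : Set (ℝ → ℂ)} {x r A : ℝ} (hr : 0 ≤ r) (hA : 0 ≤ A)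
    (h : ∀ f ∈ 𝓕, ‖f x‖ ^ 2 * r ≤ A * normSqD f) :
    ENNReal.ofReal r * supRatio 𝓕 x ≤ ENNReal.ofReal A := by
  simp only [supRatio, ENNReal.mul_iSup]
  refine iSup₂_le fun f hf => ?_
  rw [← ENNReal.ofReal_mul hr]
  refine ENNReal.ofReal_le_ofReal ?_
  rw [mul_div_assoc', mul_comm r]
  exact div_le_of_le_mul₀ (normSqD_nonneg f) hA (h f hf.1)

-- Write `D = p · (D / p)` under the integral; the bound `A` comes out and `p` has mass one. Only
-- upper estimates of the integral of `supRatio` are used, so its measurability is not needed.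
lemma kappa_le_of_reweighted {𝓕 : Set (ℝ → ℂ)} {p : ℝ → ℝ} (hp : Measurable p)
    (hp0 : ∀ x, 0 < p x) [IsProbabilityMeasure (densityMeasure p)] {A : ENNReal}
    (h : ∀ x ∈ Icc (-1 : ℝ) 1, ENNReal.ofReal (uniformDensity x / p x) * supRatio 𝓕 x ≤ A) :
    kappa 𝓕 ≤ A := by
  have hmass : ∫⁻ x in Icc (-1 : ℝ) 1, ENNReal.ofReal (p x) = 1 := by
    have := measure_univ (μ := densityMeasure p)
    rwa [densityMeasure, withDensity_apply _ MeasurableSet.univ, Measure.restrict_univ] at this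
  calc kappa 𝓕 ≤ ∫⁻ x in Icc (-1 : ℝ) 1, ENNReal.ofReal (uniformDensity x) * supRatio 𝓕 x :=
        lintegral_withDensity_le_lintegral_mul _ (by unfold uniformDensity; fun_prop) _
    _ ≤ ∫⁻ x in Icc (-1 : ℝ) 1, A * ENNReal.ofReal (p x) := by
        refine setLIntegral_mono' measurableSet_Icc fun x hx => ?_
        have e : uniformDensity x = p x * (uniformDensity x / p x) := by
          rw [mul_div_cancel₀ _ (hp0 x).ne']
        rw [e, ENNReal.ofReal_mul (hp0 x).le, mul_assoc, mul_comm A]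
        gcongr
        exact h x hx
    _ = A := by
        rw [lintegral_const_mul _ hp.ennreal_ofReal, hmass, mul_one]

end Density

theorem mainTheorem9 :
    ∃ C c₁ c₂ : ℝ, 0 < C ∧ 0 < c₁ ∧ c₁ ≤ c₂ ∧
      ∀ k : ℕ, 2 ≤ k →
        (∀ F : ℝ, 0 ≤ F →
          kappa (fourierSparse k F) ≤ ENNReal.ofReal (C * (k * Real.log k ^ 2))) ∧
        ∃ c : ℝ, c₁ ≤ c ∧ c ≤ c₂ ∧
          IsProbabilityMeasure (densityMeasure (sparseDensity k c)) ∧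
          ∀ F : ℝ, 0 ≤ F →
            (∀ f ∈ fourierSparse k F, ∀ x ∈ Icc (-1 : ℝ) 1,
              ‖f x‖ ^ 2 * (uniformDensity x / sparseDensity k c x)
                ≤ C * (k * Real.log k ^ 2) * normSqD f) ∧
            reweightedConditionNumber (fourierSparse k F) (sparseDensity k c)
              ≤ ENNReal.ofReal (C * (k * Real.log k ^ 2)) := by
  refine ⟨1000, 1 / 14, 1 / 2, by norm_num, by norm_num, by norm_num, fun k hk => ?_⟩
  obtain ⟨hm, hm'⟩ := sparseMass_mem_Icc hk
  have hprob := isProbabilityMeasure_sparseDensity hk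
  set c := (sparseMass k)⁻¹ with hc
  have hc1 : 1 / 14 ≤ c := by
    rw [hc, ← one_div]; exact one_div_le_one_div_of_le (by linarith) hm'
  have hc2 : c ≤ 1 / 2 := by
    rw [hc, ← one_div]; exact one_div_le_one_div_of_le (by norm_num) hm
  have hpos := sparseDensity_pos hk (by linarith : 0 < c)
  have hsup : ∀ F : ℝ, ∀ x ∈ Icc (-1 : ℝ) 1,
      ENNReal.ofReal (uniformDensity x / sparseDensity k c x) * supRatio (fourierSparse k F) x
        ≤ ENNReal.ofReal (1000 * (k * Real.log k ^ 2)) := fun F x hx =>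
    ofReal_density_ratio_mul_supRatio_le
      (div_nonneg (by norm_num [uniformDensity]) (hpos x).le) (by positivity)
      fun f hf => norm_sq_mul_density_ratio_le hk hc1 hf hx
  exact ⟨fun F _ => kappa_le_of_reweighted (measurable_sparseDensity c) hpos (hsup F),
    c, hc1, hc2, hprob, fun F _ =>
      ⟨fun f hf x hx => norm_sq_mul_density_ratio_le hk hc1 hf hx, iSup₂_le (hsup F)⟩⟩
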